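/- Let $\alpha\ge 0$ and $u_0\ge 0$. Let $\{T_v\}$ be i.i.d. mean-one exponential random variables indexed by the vertices $v$ of the full binary tree (root $\emptyset$). For a constant $X_0\in\{0,1\}$ define, for $n\ge 1$ and $t\ge 0$, $$X_n(t)=\begin{cases}u_0, & T_\emptyset>t,\\ X^{(1)}_{n-1}(\alpha(t-T_\emptyset))\,X^{(2)}_{n-1}(\alpha(t-T_\emptyset)), & T_\emptyset\le t,\end{cases}\tag{4.1}$$ where $X^{(1)}_{n-1},X^{(2)}_{n-1}$ are the copies of $X_{n-1}$ built from the variables on the two subtrees rooted at the children of $\emptyset$. Consider the $\alpha$-Riccati equation $$u'(t)=-u(t)+u^2(\alpha t),\quad u(0)=u_0,\qquad\text{i.e.}\qquad u(t)=u_0e^{-t}+\int_0^t e^{-s}u^2(\alpha(t-s))\,ds .\tag{2.2}$$ A solution on an interval $I$ with left end $0$ is a function that is continuous on $I$ and satisfies both forms of (2.2) there. All convergence statements hold almost surely for each $t\ge0$. The expectation $\mathbb E$ is taken in $[0,\infty]$. (i) Let $\alpha\in[0,1]\cup[2,\infty)$. If $X_0=0$ then $X_n(t)\to\underline X(t)<\infty$,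 and if $X_0=1$ then $X_n(t)\to\overline X(t)<\infty$. Let $X$ be either of the two limits and $u(t)=\mathbb E X(t)$. For every $r\ge 0$ with $u(r)<\infty$, $u$ is a solution of (2.2) on $[0,r]$. If $u_0\in[0,1]$, then $u(t)<\infty$ for all $t\ge0$ and $u$ is a solution of (2.2) on $[0,\infty)$. (ii) Let $\alpha\in(1,2)$. (a) If $X_0=0$ then $X_n(t)\to\underline X(t)<\infty$. (b) If $X_0=1$ then $X_n(t)\to\overline X(t)\le\infty$. Moreover, if $u_0>1$ then $\mathbb E\overline X(t)=\infty$ for every $t>0$, while if $u_0\in[0,1]$ then $\overline u(t)=\mathbb E\overline X(t)<\infty$ for all $t\ge0$ and $\overline u$ is a solution of (2.2) on $[0,\infty)$. -/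

import Mathlib

open MeasureTheory ProbabilityTheory Filter Topology Set
open scoped NNReal ENNReal

/-- The vertices of the full binary tree: finite words over two letters. The empty word is the root,
and `i :: v` is the vertex reached from the root through its child `i` and then along `v`. -/
abbrev TreeVertex : Type := List (Fin 2)

/-- A family of i.i.d. mean-one exponential clocks, one at each vertex of the binary tree. -/
structure IsExpCascade {Ω : Type*} [MeasurableSpace Ω] (P : Measure Ω)
    (T : TreeVertex → Ω → ℝ) : Prop where
  measurable : ∀ v, Measurable (T v)
  law : ∀ v, P.map (T v) = expMeasure 1
  indep : iIndepFun T P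

/-- The clocks of the subtree rooted at the child `i` of the root. -/
def subtreeClocks (i : Fin 2) (τ : TreeVertex → ℝ) : TreeVertex → ℝ := fun v => τ (i :: v)

/-- The stochastic iteration, as a function of the clocks `τ` on the tree and the time `t`:
`X₀ = x₀`, and `Xₙ₊₁(t)` is `u₀` if the root clock exceeds `t`, and otherwise the product of the
two copies of `Xₙ`, built on the two subtrees of the root, at the time `α (t - τ_∅)`. -/
noncomputable def riccatiIter (α : ℝ) (u₀ x₀ : ℝ≥0) : ℕ → (TreeVertex → ℝ) → ℝ → ℝ≥0
  | 0, _, _ => x₀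
  | n + 1, τ, t =>
      if t < τ [] then u₀
      else riccatiIter α u₀ x₀ n (subtreeClocks 0 τ) (α * (t - τ []))
        * riccatiIter α u₀ x₀ n (subtreeClocks 1 τ) (α * (t - τ []))

/-- The limit `X(t) ∈ [0,∞]` of the iterates (their upper limit, so that it is always defined;
that the iterates converge to it is part of what is claimed). -/
noncomputable def riccatiLimit (α : ℝ) (u₀ x₀ : ℝ≥0) (τ : TreeVertex → ℝ) (t : ℝ) : ℝ≥0∞ :=
  limsup (fun n => (riccatiIter α u₀ x₀ n τ t : ℝ≥0∞)) atTop

/-- The iterates `Xₙ(t)` started from `X₀ = x₀` converge, in `[0,∞]`, to `X(t)`. -/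
def RiccatiConverges (α : ℝ) (u₀ x₀ : ℝ≥0) (τ : TreeVertex → ℝ) (t : ℝ) : Prop :=
  Tendsto (fun n => (riccatiIter α u₀ x₀ n τ t : ℝ≥0∞)) atTop (𝓝 (riccatiLimit α u₀ x₀ τ t))

/-- The expectation `E X(t) ∈ [0,∞]` of the limit. -/
noncomputable def riccatiMean {Ω : Type*} [MeasurableSpace Ω] (P : Measure Ω)
    (T : TreeVertex → Ω → ℝ) (α : ℝ) (u₀ x₀ : ℝ≥0) (t : ℝ) : ℝ≥0∞ :=
  ∫⁻ ω, riccatiLimit α u₀ x₀ (fun v => T v ω) t ∂P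

/-- `u` solves the `α`-Riccati equation `u'(t) = -u(t) + u(α t)²`, `u(0) = u₀`, on the time interval
`I` (with left end `0`), both in the differential and in the integrated (mild) form. -/
structure IsAlphaRiccatiSolutionOn (α u₀ : ℝ) (I : Set ℝ) (u : ℝ → ℝ) : Prop where
  initial : u 0 = u₀
  continuousOn : ContinuousOn u I
  hasDeriv : ∀ t ∈ I, HasDerivWithinAt u (-u t + u (α * t) ^ 2) I t
  integrable : ∀ t ∈ I,
    IntervalIntegrable (fun s => Real.exp (-s) * u (α * (t - s)) ^ 2) volume 0 t
  mild : ∀ t ∈ I,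
    u t = u₀ * Real.exp (-t) + ∫ s in (0 : ℝ)..t, Real.exp (-s) * u (α * (t - s)) ^ 2

/-!
The iterates are monotone in `n` for every fixed choice of the clocks, so they always converge, and
the limit `X` inherits the branching recursion (`riccatiLimit_eq_ite`): no product `0 * ∞` can
occur. Under the law of i.i.d. exponential clocks the root clock and the two subtrees are
independent, each subtree being a copy of the whole tree (`map_graftClocks`). Conditioning on the
root clock therefore turns the recursion into integral equations in `[0, ∞]`; in terms of the
remaining time `σ = t - s` the mean `U` satisfies
`exp t * U t = u₀ + ∫ σ in (0, t], exp σ * U (α σ) ^ 2` (`limitMean_eq`).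

* *Solutions.* The function `exp t * U t` is nondecreasing, so finiteness at `r` gives finiteness on
  `[0, r]`, and for `α > 1` on all of `[0, ∞)`, because the equation at `r` involves the values at
  almost all times up to `α r`. Hence the integrand is integrable, `U` is continuous, and the
  fundamental theorem of calculus applies
  (`IsExtendedRiccatiSolution.isAlphaRiccatiSolutionOn_Icc`).
* *Finiteness from `x₀ = 0`.* The iterates are eventually constant as soon as one is nonzero.
* *Finiteness from `x₀ = 1`, `u₀ > 1`.* The probability `p` that the limit is infinite satisfies
  `exp t * p t = ∫ σ in (0, t], exp σ * (2 p - p ^ 2) (α σ)`. For `α ≤ 1` Gronwall's argument gives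
  `p = 0`. For `α ≥ 2` an explicit supersolution shows that a leaf is exponentially unlikely at late
  times (`measure_leafSet_le`), so `p` is integrable; integrating the equation over `(0, ∞)` gives
  `∫ p + ∫ p (α t) ^ 2 = (2 / α) ∫ p ≤ ∫ p`, which forces `p = 0`. The quadratic term is what
  settles the critical case `α = 2`.
* *Infinite mean for `1 < α < 2`, `u₀ > 1`.* The excess `v = U - 1 > 0` satisfies the linear
  inequality with kernel `2 v (α σ)`. Integrated over `(0, T]` it bounds `V = ∫ v` from below by
  `(2 / α) (1 - exp (-(1 - 1 / α) T)) V`, which is impossible for a finite `V` and large `T`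
  (`limitMean_eq_top`).
-/

/-! ### The law of the clocks and its decomposition at the root -/

instance isProbabilityMeasure_expMeasure_one : IsProbabilityMeasure (expMeasure 1) :=
  isProbabilityMeasure_expMeasure one_pos

/-- The law of a family of i.i.d. mean-one exponential clocks on the vertices of the tree. -/
noncomputable def clockLaw : Measure (TreeVertex → ℝ) :=
  Measure.infinitePi fun _ => expMeasure 1

instance isProbabilityMeasure_clockLaw : IsProbabilityMeasure clockLaw := by
  unfold clockLaw; infer_instance

theorem clockLaw_pi {s : Finset TreeVertex} {t : TreeVertex → Set ℝ}
    (ht : ∀ v ∈ s, MeasurableSet (t v)) :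
    clockLaw (Set.pi s t) = ∏ v ∈ s, expMeasure 1 (t v) :=
  Measure.infinitePi_pi (fun _ : TreeVertex => expMeasure 1) ht

theorem IsExpCascade.map_eq_clockLaw {Ω : Type*} [MeasurableSpace Ω] {P : Measure Ω}
    {T : TreeVertex → Ω → ℝ} (hT : IsExpCascade P T) :
    P.map (fun ω v => T v ω) = clockLaw := by
  rw [hT.indep.map_fun_eq_infinitePi_map hT.measurable]
  simp only [hT.law, clockLaw]

/-- The clocks on the whole tree assembled from a root clock and the clocks of the two subtrees:
the inverse of `τ ↦ (τ [], subtreeClocks 0 τ, subtreeClocks 1 τ)`. -/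
def graftClocks (p : ℝ × (TreeVertex → ℝ) × (TreeVertex → ℝ)) : TreeVertex → ℝ
  | [] => p.1
  | i :: v => if i = 0 then p.2.1 v else p.2.2 v

theorem measurable_graftClocks : Measurable graftClocks := by
  refine measurable_pi_iff.2 fun v => ?_
  rcases v with _ | ⟨i, v⟩
  · exact measurable_fst
  · by_cases hi : i = 0
    · simp only [graftClocks, hi, if_true]; fun_prop
    · simp only [graftClocks, hi, if_false]; fun_prop

theorem measurable_subtreeClocks (i : Fin 2) : Measurable (subtreeClocks i) :=
  measurable_pi_iff.2 fun v => measurable_pi_apply (i :: v)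

@[simp] theorem subtreeClocks_zero_graftClocks (p : ℝ × (TreeVertex → ℝ) × (TreeVertex → ℝ)) :
    subtreeClocks 0 (graftClocks p) = p.2.1 := by
  funext v; simp [subtreeClocks, graftClocks]

@[simp] theorem subtreeClocks_one_graftClocks (p : ℝ × (TreeVertex → ℝ) × (TreeVertex → ℝ)) :
    subtreeClocks 1 (graftClocks p) = p.2.2 := by
  funext v; simp [subtreeClocks, graftClocks]

/-- The root clock and the two families of subtree clocks are independent, and each subtree carries
a copy of the whole family. -/
theorem map_graftClocks :
    ((expMeasure 1).prod (clockLaw.prod clockLaw)).map graftClocks = clockLaw := by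
  classical
  refine Measure.eq_infinitePi _ fun s t ht => ?_
  have hinj (i : Fin 2) : Function.Injective (fun v : TreeVertex => i :: v) :=
    List.cons_injective
  set s₀ := s.preimage (fun v : TreeVertex => (0 : Fin 2) :: v) (hinj 0).injOn
  set s₁ := s.preimage (fun v : TreeVertex => (1 : Fin 2) :: v) (hinj 1).injOn
  have hpre : graftClocks ⁻¹' (Set.pi s t) = {x | [] ∈ s → x ∈ t []} ×ˢ
      ((Set.pi s₀ fun v => t (0 :: v)) ×ˢ (Set.pi s₁ fun v => t (1 :: v))) := by
    ext ⟨x, a, b⟩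
    simp only [mem_preimage, Set.mem_pi, mem_prod, mem_ofPred_eq, s₀, s₁, Finset.mem_coe,
      Finset.mem_preimage]
    constructor
    · intro h
      exact ⟨h [], fun v hv => by simpa [graftClocks] using h _ hv,
        fun v hv => by simpa [graftClocks] using h _ hv⟩
    · rintro ⟨h, h₀, h₁⟩ v hv
      rcases v with _ | ⟨i, v⟩
      · exact h hv
      · fin_cases i
        · simpa [graftClocks] using h₀ v hv
        · simpa [graftClocks] using h₁ v hv
  rw [Measure.map_apply measurable_graftClocks (MeasurableSet.pi s.countable_toSet fun i _ => ht i),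
    hpre, Measure.prod_prod, Measure.prod_prod, clockLaw_pi fun i _ => ht _,
    clockLaw_pi fun i _ => ht _]
  have h₀ := Finset.prod_preimage' (fun v : TreeVertex => (0 : Fin 2) :: v) s (hinj 0).injOn
    (fun v => expMeasure 1 (t v))
  have h₁ := Finset.prod_preimage' (fun v : TreeVertex => (1 : Fin 2) :: v) s (hinj 1).injOn
    (fun v => expMeasure 1 (t v))
  have hr : expMeasure 1 {x | [] ∈ s → x ∈ t []} = ∏ v ∈ s with v = [], expMeasure 1 (t v) := by
    rw [Finset.prod_filter]
    by_cases h : [] ∈ s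
    · rw [Finset.prod_eq_single_of_mem [] h fun v _ hv => if_neg hv]
      simp [h]
    · rw [Finset.prod_eq_one fun v hv => if_neg (by rintro rfl; exact h hv)]
      simp [h]
  rw [h₀, h₁, hr, ← Finset.prod_union, ← Finset.prod_union]
  · congr 1
    ext v
    rcases v with _ | ⟨i, v⟩
    · simp
    · fin_cases i <;> simp
  · rw [Finset.disjoint_left]
    rintro v hv hv'
    simp only [Finset.mem_filter, Finset.mem_union, mem_range] at hv hv'
    rcases hv.2 with rfl
    simp at hv'
  · rw [Finset.disjoint_left]
    rintro v hv hv'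
    simp only [Finset.mem_filter, mem_range] at hv hv'
    obtain ⟨w, rfl⟩ := hv.2
    simp at hv'

/-- An integral over an exponential clock `s`, split according to whether `s` exceeds `t`, written
in terms of the remaining time `σ = t - s`. -/
theorem lintegral_expMeasure_ite {t : ℝ} (ht : 0 ≤ t) (c : ℝ≥0∞) {h : ℝ → ℝ≥0∞}
    (hh : Measurable h) :
    ∫⁻ s, (if t < s then c else h (t - s)) ∂(expMeasure 1)
      = ENNReal.ofReal (Real.exp (-t)) *
        (c + ∫⁻ σ in Ioc 0 t, ENNReal.ofReal (Real.exp σ) * h σ) := by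
  have hm : Measurable fun s => if t < s then c else h (t - s) :=
    Measurable.ite (measurableSet_lt measurable_const measurable_id) measurable_const (by fun_prop)
  have hpdf : Measurable (exponentialPDF 1) := (measurable_exponentialPDFReal 1).ennreal_ofReal
  have hexp : expMeasure 1 = volume.withDensity (exponentialPDF 1) := rfl
  rw [hexp, lintegral_withDensity_eq_lintegral_mul _ hpdf hm,
    ← lintegral_sub_left_eq_self _ t]
  have hpt : ∀ σ : ℝ, (exponentialPDF 1 * fun s => if t < s then c else h (t - s)) (t - σ)
      = (Iio 0).indicator (fun σ => ENNReal.ofReal (Real.exp (-t)) * c *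
          ENNReal.ofReal (Real.exp σ)) σ
        + (Icc 0 t).indicator (fun σ => ENNReal.ofReal (Real.exp (-t)) *
          (ENNReal.ofReal (Real.exp σ) * h σ)) σ := by
    intro σ
    have hE : ENNReal.ofReal (Real.exp (σ - t))
        = ENNReal.ofReal (Real.exp (-t)) * ENNReal.ofReal (Real.exp σ) := by
      rw [← ENNReal.ofReal_mul (Real.exp_pos _).le, ← Real.exp_add]; ring_nf
    rcases lt_or_ge σ 0 with hσ | hσ
    · have h1 : σ ∉ Icc 0 t := fun h => absurd h.1 (not_le.2 hσ)
      simp only [Pi.mul_apply, indicator_of_mem (mem_Iio.2 hσ), indicator_of_notMem h1, add_zero,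
        show t < t - σ by linarith, if_true, exponentialPDF_of_nonneg (show 0 ≤ t - σ by linarith), one_mul,
        neg_sub, hE]
      ring
    · have h1 : σ ∉ Iio (0 : ℝ) := not_lt.2 hσ
      have h2 : ¬ t < t - σ := by linarith
      rcases le_or_gt σ t with hσt | hσt
      · simp only [Pi.mul_apply, indicator_of_mem (mem_Icc.2 ⟨hσ, hσt⟩), indicator_of_notMem h1,
          zero_add, h2, if_false, exponentialPDF_of_nonneg (show 0 ≤ t - σ by linarith), one_mul,
          neg_sub, hE, sub_sub_cancel]
        ring
      · have h3 : σ ∉ Icc 0 t := fun h => absurd h.2 (not_le.2 hσt)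
        simp only [Pi.mul_apply, indicator_of_notMem h3, indicator_of_notMem h1,
          exponentialPDF_of_neg (show t - σ < 0 by linarith), zero_mul, add_zero]
  have hint : ∫⁻ σ in Iio (0 : ℝ), ENNReal.ofReal (Real.exp σ) = 1 := by
    rw [← setLIntegral_congr Iio_ae_eq_Iic.symm, ← ofReal_integral_eq_lintegral_ofReal
      (integrableOn_exp_Iic 0) (Eventually.of_forall fun x => (Real.exp_pos x).le),
      integral_exp_Iic_zero, ENNReal.ofReal_one]
  simp_rw [hpt]
  rw [lintegral_add_left (by measurability), lintegral_indicator measurableSet_Iio,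
    lintegral_indicator measurableSet_Icc, lintegral_const_mul _ (by fun_prop), hint,
    lintegral_const_mul _ (by fun_prop), mul_one, mul_add, setLIntegral_congr Ioc_ae_eq_Icc]

/-- Conditioning on the root clock: the expectation of a functional which is `c` before the root
clock rings and afterwards depends on the two subtrees and on the rescaled remaining time. -/
theorem lintegral_clockLaw_ite (α : ℝ) {t : ℝ} (ht : 0 ≤ t) (c : ℝ≥0∞)
    {K : (TreeVertex → ℝ) → (TreeVertex → ℝ) → ℝ → ℝ≥0∞}
    (hK : Measurable fun p : (TreeVertex → ℝ) × (TreeVertex → ℝ) × ℝ => K p.1 p.2.1 p.2.2) :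
    ∫⁻ τ, (if t < τ [] then c
        else K (subtreeClocks 0 τ) (subtreeClocks 1 τ) (α * (t - τ []))) ∂clockLaw
      = ENNReal.ofReal (Real.exp (-t)) * (c + ∫⁻ σ in Ioc 0 t, ENNReal.ofReal (Real.exp σ) *
          ∫⁻ p, K p.1 p.2 (α * σ) ∂(clockLaw.prod clockLaw)) := by
  have h0 := measurable_subtreeClocks 0
  have h1 := measurable_subtreeClocks 1
  have hm : Measurable fun τ : TreeVertex → ℝ => if t < τ [] then c
        else K (subtreeClocks 0 τ) (subtreeClocks 1 τ) (α * (t - τ [])) := by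
    refine Measurable.ite (measurableSet_lt measurable_const (measurable_pi_apply _))
      measurable_const ?_
    exact hK.comp (h0.prodMk (h1.prodMk (by fun_prop)))
  have hm' := hm.comp measurable_graftClocks
  have hg : Measurable fun σ : ℝ => ∫⁻ p, K p.1 p.2 (α * σ) ∂(clockLaw.prod clockLaw) := by
    refine Measurable.lintegral_prod_right' (f := fun q : ℝ × (TreeVertex → ℝ) × (TreeVertex → ℝ) =>
      K q.2.1 q.2.2 (α * q.1)) ?_
    exact hK.comp (by fun_prop : Measurable fun q : ℝ × (TreeVertex → ℝ) × (TreeVertex → ℝ) =>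
      (q.2.1, q.2.2, α * q.1))
  rw [← lintegral_expMeasure_ite ht c hg]
  conv_lhs => rw [← map_graftClocks]
  rw [lintegral_map hm measurable_graftClocks, lintegral_prod _ (by exact hm'.aemeasurable)]
  refine lintegral_congr fun s => ?_
  have hs : ∀ q, graftClocks (s, q) [] = s := fun q => rfl
  simp only [hs, subtreeClocks_zero_graftClocks, subtreeClocks_one_graftClocks]
  split_ifs <;> simp

/-! ### Pathwise convergence and the branching identity of the limit -/

theorem riccatiIter_succ_of_lt {α : ℝ} {u₀ x₀ : ℝ≥0} {n : ℕ} {τ : TreeVertex → ℝ} {t : ℝ}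
    (h : t < τ []) : riccatiIter α u₀ x₀ (n + 1) τ t = u₀ := by
  simp [riccatiIter, h]

theorem riccatiIter_succ_of_le {α : ℝ} {u₀ x₀ : ℝ≥0} {n : ℕ} {τ : TreeVertex → ℝ} {t : ℝ}
    (h : τ [] ≤ t) : riccatiIter α u₀ x₀ (n + 1) τ t =
      riccatiIter α u₀ x₀ n (subtreeClocks 0 τ) (α * (t - τ [])) *
        riccatiIter α u₀ x₀ n (subtreeClocks 1 τ) (α * (t - τ [])) := by
  simp [riccatiIter, not_lt.2 h]

theorem measurable_riccatiIter (α : ℝ) (u₀ x₀ : ℝ≥0) (n : ℕ) :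
    Measurable fun p : (TreeVertex → ℝ) × ℝ => riccatiIter α u₀ x₀ n p.1 p.2 := by
  induction n with
  | zero => exact measurable_const
  | succ n ih =>
    have hr : Measurable fun p : (TreeVertex → ℝ) × ℝ => p.1 [] :=
      (measurable_pi_apply []).comp measurable_fst
    have hs (i : Fin 2) : Measurable fun p : (TreeVertex → ℝ) × ℝ =>
        riccatiIter α u₀ x₀ n (subtreeClocks i p.1) (α * (p.2 - p.1 [])) :=
      ih.comp (((measurable_subtreeClocks i).comp measurable_fst).prodMk
        ((measurable_snd.sub hr).const_mul α))
    exact Measurable.ite (measurableSet_lt measurable_snd hr) measurable_const ((hs 0).mul (hs 1))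

theorem measurable_riccatiLimit (α : ℝ) (u₀ x₀ : ℝ≥0) :
    Measurable fun p : (TreeVertex → ℝ) × ℝ => riccatiLimit α u₀ x₀ p.1 p.2 :=
  Measurable.limsup fun n => (measurable_riccatiIter α u₀ x₀ n).coe_nnreal_ennreal

theorem measurable_riccatiLimit_left (α : ℝ) (u₀ x₀ : ℝ≥0) (t : ℝ) :
    Measurable fun τ : TreeVertex → ℝ => riccatiLimit α u₀ x₀ τ t := by
  have h : Measurable fun τ : TreeVertex → ℝ => (τ, t) := measurable_prodMk_right
  have h' := (measurable_riccatiLimit α u₀ x₀).comp h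
  exact h'

theorem riccatiIter_le_succ {α : ℝ} {u₀ x₀ : ℝ≥0} (h₀ : x₀ ≤ u₀) (h₁ : x₀ ≤ x₀ * x₀) (n : ℕ) :
    ∀ τ t, riccatiIter α u₀ x₀ n τ t ≤ riccatiIter α u₀ x₀ (n + 1) τ t := by
  induction n with
  | zero =>
    intro τ t
    rcases lt_or_ge t (τ []) with h | h
    · simpa [riccatiIter, h] using h₀
    · simpa [riccatiIter, not_lt.2 h] using h₁
  | succ n ih =>
    intro τ t
    rcases lt_or_ge t (τ []) with h | h
    · simp only [riccatiIter_succ_of_lt h, le_refl]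
    · rw [riccatiIter_succ_of_le h, riccatiIter_succ_of_le h]
      exact mul_le_mul' (ih _ _) (ih _ _)

theorem riccatiIter_succ_le {α : ℝ} {u₀ x₀ : ℝ≥0} (h₀ : u₀ ≤ x₀) (h₁ : x₀ * x₀ ≤ x₀) (n : ℕ) :
    ∀ τ t, riccatiIter α u₀ x₀ (n + 1) τ t ≤ riccatiIter α u₀ x₀ n τ t := by
  induction n with
  | zero =>
    intro τ t
    rcases lt_or_ge t (τ []) with h | h
    · simpa [riccatiIter, h] using h₀
    · simpa [riccatiIter, not_lt.2 h] using h₁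
  | succ n ih =>
    intro τ t
    rcases lt_or_ge t (τ []) with h | h
    · simp only [riccatiIter_succ_of_lt h, le_refl]
    · rw [riccatiIter_succ_of_le h, riccatiIter_succ_of_le h]
      exact mul_le_mul' (ih _ _) (ih _ _)

/-- For `x₀ ∈ {0, 1}` the iterates are monotone in `n`, increasing if `x₀ ≤ u₀` and decreasing
otherwise, so that they converge for every choice of the clocks. -/
theorem riccatiConverges {x₀ : ℝ≥0} (hx : x₀ = 0 ∨ x₀ = 1) (α : ℝ) (u₀ : ℝ≥0)
    (τ : TreeVertex → ℝ) (t : ℝ) : RiccatiConverges α u₀ x₀ τ t := by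
  have hx' : x₀ * x₀ = x₀ := by rcases hx with rfl | rfl <;> simp
  have key : ∃ l, Tendsto (fun n => (riccatiIter α u₀ x₀ n τ t : ℝ≥0∞)) atTop (𝓝 l) := by
    rcases le_total x₀ u₀ with h | h
    · exact ⟨_, tendsto_atTop_iSup (monotone_nat_of_le_succ fun n =>
        ENNReal.coe_le_coe.2 (riccatiIter_le_succ h hx'.ge n τ t))⟩
    · exact ⟨_, tendsto_atTop_iInf (antitone_nat_of_succ_le fun n =>
        ENNReal.coe_le_coe.2 (riccatiIter_succ_le h hx'.le n τ t))⟩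
  obtain ⟨l, hl⟩ := key
  unfold RiccatiConverges riccatiLimit
  rwa [hl.limsup_eq]

theorem riccatiIter_le_one {α : ℝ} {u₀ x₀ : ℝ≥0} (hu : u₀ ≤ 1) (hx : x₀ ≤ 1) (n : ℕ) :
    ∀ τ t, riccatiIter α u₀ x₀ n τ t ≤ 1 := by
  induction n with
  | zero => intro τ t; simpa [riccatiIter] using hx
  | succ n ih =>
    intro τ t
    rcases lt_or_ge t (τ []) with h | h
    · simpa [riccatiIter_succ_of_lt h] using hu
    · rw [riccatiIter_succ_of_le h]
      exact mul_le_one' (ih _ _) (ih _ _)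

theorem one_le_riccatiIter {α : ℝ} {u₀ x₀ : ℝ≥0} (hu : 1 ≤ u₀) (hx : 1 ≤ x₀) (n : ℕ) :
    ∀ τ t, 1 ≤ riccatiIter α u₀ x₀ n τ t := by
  induction n with
  | zero => intro τ t; simpa [riccatiIter] using hx
  | succ n ih =>
    intro τ t
    rcases lt_or_ge t (τ []) with h | h
    · simpa [riccatiIter_succ_of_lt h] using hu
    · rw [riccatiIter_succ_of_le h]
      exact one_le_mul (ih _ _) (ih _ _)

theorem riccatiLimit_le_one {α : ℝ} {u₀ x₀ : ℝ≥0} (hu : u₀ ≤ 1) (hx : x₀ ≤ 1)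
    (τ : TreeVertex → ℝ) (t : ℝ) : riccatiLimit α u₀ x₀ τ t ≤ 1 :=
  (limsup_le_limsup (Eventually.of_forall fun n =>
    ENNReal.coe_le_coe.2 (riccatiIter_le_one hu hx n τ t))).trans_eq (by simp)

theorem one_le_riccatiLimit {α : ℝ} {u₀ : ℝ≥0} (hu : 1 ≤ u₀) (τ : TreeVertex → ℝ) (t : ℝ) :
    1 ≤ riccatiLimit α u₀ 1 τ t :=
  ge_of_tendsto (riccatiConverges (Or.inr rfl) α u₀ τ t) (Eventually.of_forall fun n => by
    exact_mod_cast one_le_riccatiIter hu le_rfl n τ t)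

/-- Started from `0`, the iteration is constant as soon as it is nonzero: the tree explored up to
time `t` then has at most `n` generations, and a larger `n` adds no vertices to it. -/
theorem riccatiIter_zero_eq_zero_or (α : ℝ) (u₀ : ℝ≥0) (n : ℕ) :
    ∀ τ t, riccatiIter α u₀ 0 n τ t = 0 ∨
      ∀ k, riccatiIter α u₀ 0 (n + k) τ t = riccatiIter α u₀ 0 n τ t := by
  induction n with
  | zero => intro τ t; exact Or.inl rfl
  | succ n ih =>
    intro τ t
    rcases lt_or_ge t (τ []) with h | h
    · right
      intro k
      rw [Nat.add_right_comm, riccatiIter_succ_of_lt h, riccatiIter_succ_of_lt h]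
    · rcases ih (subtreeClocks 0 τ) (α * (t - τ [])) with h0 | h0
      · left; rw [riccatiIter_succ_of_le h, h0, zero_mul]
      rcases ih (subtreeClocks 1 τ) (α * (t - τ [])) with h1 | h1
      · left; rw [riccatiIter_succ_of_le h, h1, mul_zero]
      right
      intro k
      rw [Nat.add_right_comm, riccatiIter_succ_of_le h, riccatiIter_succ_of_le h, h0, h1]

theorem riccatiLimit_zero_lt_top (α : ℝ) (u₀ : ℝ≥0) (τ : TreeVertex → ℝ) (t : ℝ) :
    riccatiLimit α u₀ 0 τ t < ∞ := by
  by_cases h : ∀ n, riccatiIter α u₀ 0 n τ t = 0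
  · simp [riccatiLimit, h]
  · push Not at h
    obtain ⟨n, hn⟩ := h
    have hk := (riccatiIter_zero_eq_zero_or α u₀ n τ t).resolve_left hn
    have hl : Tendsto (fun m => (riccatiIter α u₀ 0 m τ t : ℝ≥0∞)) atTop
        (𝓝 (riccatiIter α u₀ 0 n τ t : ℝ≥0∞)) := by
      refine tendsto_const_nhds.congr' ?_
      filter_upwards [eventually_ge_atTop n] with m hm
      obtain ⟨k, rfl⟩ := Nat.exists_eq_add_of_le hm
      rw [hk]
    rw [tendsto_nhds_unique (riccatiConverges (Or.inl rfl) α u₀ τ t) hl]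
    exact ENNReal.coe_lt_top

/-- The limit inherits the branching recursion of the iterates: no indeterminate product `0 * ∞`
occurs, because the limits are either all finite or all at least `1`. -/
theorem riccatiLimit_eq_ite {x₀ : ℝ≥0} (hx : x₀ = 0 ∨ x₀ = 1) (α : ℝ) (u₀ : ℝ≥0)
    (τ : TreeVertex → ℝ) (t : ℝ) :
    riccatiLimit α u₀ x₀ τ t = if t < τ [] then (u₀ : ℝ≥0∞) else
      riccatiLimit α u₀ x₀ (subtreeClocks 0 τ) (α * (t - τ [])) *
        riccatiLimit α u₀ x₀ (subtreeClocks 1 τ) (α * (t - τ [])) := by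
  have hsucc := (riccatiConverges hx α u₀ τ t).comp (tendsto_add_atTop_nat 1)
  refine tendsto_nhds_unique hsucc ?_
  split_ifs with h
  · simp only [Function.comp_def, riccatiIter_succ_of_lt h]
    exact tendsto_const_nhds
  · simp only [Function.comp_def, riccatiIter_succ_of_le (not_lt.1 h), ENNReal.coe_mul]
    have hcase : (∀ τ t, riccatiLimit α u₀ x₀ τ t ≠ ∞) ∨ ∀ τ t, riccatiLimit α u₀ x₀ τ t ≠ 0 := by
      rcases hx with rfl | rfl
      · exact Or.inl fun τ t => (riccatiLimit_zero_lt_top α u₀ τ t).ne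
      · rcases le_total u₀ 1 with hu | hu
        · exact Or.inl fun τ t =>
            ((riccatiLimit_le_one hu le_rfl τ t).trans_lt ENNReal.one_lt_top).ne
        · exact Or.inr fun τ t => (one_pos.trans_le (one_le_riccatiLimit hu τ t)).ne'
    refine ENNReal.Tendsto.mul (riccatiConverges hx α u₀ _ _) ?_ (riccatiConverges hx α u₀ _ _) ?_
    · exact hcase.elim (fun h => Or.inr (h _ _)) fun h => Or.inl (h _ _)
    · exact hcase.elim (fun h => Or.inr (h _ _)) fun h => Or.inl (h _ _)

/-! ### The integral equation for the mean -/

/-- The mean of the limit over the law of the clocks. -/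
noncomputable def limitMean (α : ℝ) (u₀ x₀ : ℝ≥0) (t : ℝ) : ℝ≥0∞ :=
  ∫⁻ τ, riccatiLimit α u₀ x₀ τ t ∂clockLaw

theorem riccatiMean_eq_limitMean {Ω : Type*} [MeasurableSpace Ω] {P : Measure Ω}
    {T : TreeVertex → Ω → ℝ} (hT : IsExpCascade P T) (α : ℝ) (u₀ x₀ : ℝ≥0) :
    riccatiMean P T α u₀ x₀ = limitMean α u₀ x₀ := by
  funext t
  rw [riccatiMean, limitMean, ← hT.map_eq_clockLaw,
    lintegral_map (measurable_riccatiLimit_left α u₀ x₀ t) (measurable_pi_iff.2 hT.measurable)]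

theorem measurable_limitMean (α : ℝ) (u₀ x₀ : ℝ≥0) : Measurable (limitMean α u₀ x₀) :=
  (measurable_riccatiLimit α u₀ x₀).lintegral_prod_left'

/-- The mean satisfies the mild form of the `α`-Riccati equation in `[0, ∞]`, written in terms of
the remaining time `σ = t - s`. -/
theorem limitMean_eq {x₀ : ℝ≥0} (hx : x₀ = 0 ∨ x₀ = 1) (α : ℝ) (u₀ : ℝ≥0) {t : ℝ} (ht : 0 ≤ t) :
    limitMean α u₀ x₀ t = ENNReal.ofReal (Real.exp (-t)) *
      (u₀ + ∫⁻ σ in Ioc 0 t, ENNReal.ofReal (Real.exp σ) * limitMean α u₀ x₀ (α * σ) ^ 2) := by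
  have hX := measurable_riccatiLimit α u₀ x₀
  have hK : Measurable fun p : (TreeVertex → ℝ) × (TreeVertex → ℝ) × ℝ =>
      riccatiLimit α u₀ x₀ p.1 p.2.2 * riccatiLimit α u₀ x₀ p.2.1 p.2.2 :=
    (hX.comp (by fun_prop : Measurable fun p : (TreeVertex → ℝ) × (TreeVertex → ℝ) × ℝ =>
      (p.1, p.2.2))).mul
    (hX.comp (by fun_prop : Measurable fun p : (TreeVertex → ℝ) × (TreeVertex → ℝ) × ℝ =>
      (p.2.1, p.2.2)))
  have h := lintegral_clockLaw_ite α ht u₀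
    (K := fun a b s => riccatiLimit α u₀ x₀ a s * riccatiLimit α u₀ x₀ b s) hK
  simp_rw [← riccatiLimit_eq_ite hx] at h
  rw [limitMean, h]
  congr 3
  funext σ
  rw [lintegral_prod_mul (measurable_riccatiLimit_left α u₀ x₀ _).aemeasurable
    (measurable_riccatiLimit_left α u₀ x₀ _).aemeasurable, sq, limitMean]

/-! ### From the integral equation in `[0, ∞]` to classical solutions -/

/-- The mild form of the `α`-Riccati equation for a function with values in `[0, ∞]`, in terms of
the remaining time `σ = t - s`. -/
structure IsExtendedRiccatiSolution (α : ℝ) (c : ℝ≥0) (U : ℝ → ℝ≥0∞) : Prop where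
  measurable : Measurable U
  eq : ∀ t, 0 ≤ t → U t = ENNReal.ofReal (Real.exp (-t)) *
    (c + ∫⁻ σ in Ioc 0 t, ENNReal.ofReal (Real.exp σ) * U (α * σ) ^ 2)

theorem isExtendedRiccatiSolution_limitMean {x₀ : ℝ≥0} (hx : x₀ = 0 ∨ x₀ = 1) (α : ℝ) (u₀ : ℝ≥0) :
    IsExtendedRiccatiSolution α u₀ (limitMean α u₀ x₀) :=
  ⟨measurable_limitMean α u₀ x₀, fun _ ht => limitMean_eq hx α u₀ ht⟩

theorem ofReal_exp_mul_ofReal_exp_neg_mul (t : ℝ) (x : ℝ≥0∞) :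
    ENNReal.ofReal (Real.exp t) * (ENNReal.ofReal (Real.exp (-t)) * x) = x := by
  rw [← mul_assoc, ← ENNReal.ofReal_mul (Real.exp_pos t).le, ← Real.exp_add]
  simp

namespace IsExtendedRiccatiSolution

variable {α : ℝ} {c : ℝ≥0} {U : ℝ → ℝ≥0∞}

theorem exp_mul_eq (h : IsExtendedRiccatiSolution α c U) {t : ℝ} (ht : 0 ≤ t) :
    ENNReal.ofReal (Real.exp t) * U t =
      c + ∫⁻ σ in Ioc 0 t, ENNReal.ofReal (Real.exp σ) * U (α * σ) ^ 2 := by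
  rw [h.eq t ht, ofReal_exp_mul_ofReal_exp_neg_mul]

theorem exp_mul_mono (h : IsExtendedRiccatiSolution α c U) {s t : ℝ} (hs : 0 ≤ s) (hst : s ≤ t) :
    ENNReal.ofReal (Real.exp s) * U s ≤ ENNReal.ofReal (Real.exp t) * U t := by
  rw [h.exp_mul_eq hs, h.exp_mul_eq (hs.trans hst)]
  gcongr

theorem le_exp_mul (h : IsExtendedRiccatiSolution α c U) {s t : ℝ} (hs : 0 ≤ s) (hst : s ≤ t) :
    U s ≤ ENNReal.ofReal (Real.exp t) * U t :=
  le_trans (le_mul_of_one_le_left' (by simpa using hs)) (h.exp_mul_mono hs hst)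

theorem lt_top_of_le (h : IsExtendedRiccatiSolution α c U) {s t : ℝ} (hs : 0 ≤ s) (hst : s ≤ t)
    (ht : U t < ∞) : U s < ∞ :=
  (h.le_exp_mul hs hst).trans_lt (ENNReal.mul_lt_top ENNReal.ofReal_lt_top ht)

theorem lintegral_lt_top (h : IsExtendedRiccatiSolution α c U) {t : ℝ} (ht : 0 ≤ t)
    (hU : U t < ∞) : ∫⁻ σ in Ioc 0 t, ENNReal.ofReal (Real.exp σ) * U (α * σ) ^ 2 < ∞ := by
  have h1 : ENNReal.ofReal (Real.exp t) * U t < ∞ := ENNReal.mul_lt_top ENNReal.ofReal_lt_top hU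
  rw [h.exp_mul_eq ht] at h1
  exact lt_of_le_of_lt le_add_self h1

theorem measurable_integrand (h : IsExtendedRiccatiSolution α c U) :
    Measurable fun σ => ENNReal.ofReal (Real.exp σ) * U (α * σ) ^ 2 := by
  have := h.measurable
  fun_prop

/-- For `α > 1` the value at `r` involves the values up to time `α r`, so that finiteness at one
positive time propagates to later and later times. -/
theorem lt_top_forward (h : IsExtendedRiccatiSolution α c U) (hα : 1 < α) {r : ℝ} (hr : 0 < r)
    (hU : U r < ∞) {t : ℝ} (ht : 0 ≤ t) : U t < ∞ := by
  set b := (1 + α) / 2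
  have hb : 1 < b := by simp only [b]; linarith
  have hbα : b < α := by simp only [b]; linarith
  have step : ∀ s, 0 < s → U s < ∞ → U (b * s) < ∞ := by
    intro s hs hUs
    have hae := ae_lt_top h.measurable_integrand (h.lintegral_lt_top hs.le hUs).ne
    have hlt : b / α * s < s := by
      have : b / α < 1 := (div_lt_one (by linarith)).2 hbα
      nlinarith
    have hpos : 0 ≤ b / α * s := by positivity
    -- almost every point of `(0, s]` is good; pick one in `(b s / α, s]`
    have hsub : Ioc (b / α * s) s ⊆ Ioc 0 s := Ioc_subset_Ioc_left hpos
    have hae' : ∀ᵐ σ ∂(volume.restrict (Ioc (b / α * s) s)),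
        ENNReal.ofReal (Real.exp σ) * U (α * σ) ^ 2 < ∞ :=
      ae_mono (Measure.restrict_mono_set volume hsub) hae
    have : (ae (volume.restrict (Ioc (b / α * s) s))).NeBot := by
      rw [ae_neBot]; simpa using hlt
    obtain ⟨σ, hσ, hσm⟩ := (hae'.and (ae_restrict_mem measurableSet_Ioc)).exists
    have hfin : U (α * σ) < ∞ := by
      by_contra hcon
      rw [not_lt, top_le_iff] at hcon
      rw [hcon] at hσ
      simp [ENNReal.mul_top, Real.exp_pos] at hσ
    refine h.lt_top_of_le (by positivity) ?_ hfin
    have := hσm.1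
    rw [div_mul_eq_mul_div, div_lt_iff₀ (by linarith)] at this
    linarith
  have iter : ∀ n : ℕ, U (b ^ n * r) < ∞ := by
    intro n
    induction n with
    | zero => simpa using hU
    | succ n ih =>
      have := step _ (by positivity) ih
      rwa [← mul_assoc, ← pow_succ'] at this
  obtain ⟨n, hn⟩ := pow_unbounded_of_one_lt (t / r) hb
  exact h.lt_top_of_le ht ((div_lt_iff₀ hr).1 hn).le (iter n)

theorem lt_top_scale (h : IsExtendedRiccatiSolution α c U) (hα : 0 ≤ α) {r : ℝ} (hr : 0 ≤ r)
    (hU : U r < ∞) : U (α * r) < ∞ := by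
  rcases le_or_gt α 1 with h1 | h1
  · exact h.lt_top_of_le (by positivity) (mul_le_of_le_one_left hr h1) hU
  · rcases hr.eq_or_lt with rfl | hr'
    · simpa using hU
    · exact h.lt_top_forward h1 hr' hU (by positivity)

theorem intervalIntegrable (h : IsExtendedRiccatiSolution α c U) {t : ℝ} (ht : 0 ≤ t)
    (hU : U t < ∞) :
    IntervalIntegrable (fun σ => Real.exp σ * (U (α * σ)).toReal ^ 2) volume 0 t := by
  rw [intervalIntegrable_iff_integrableOn_Ioc_of_le ht]
  have := integrable_toReal_of_lintegral_ne_top h.measurable_integrand.aemeasurable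
    (h.lintegral_lt_top ht hU).ne
  simpa [IntegrableOn, ENNReal.toReal_mul, ENNReal.toReal_pow, (Real.exp_pos _).le] using this

theorem toReal_eq (h : IsExtendedRiccatiSolution α c U) {t : ℝ} (ht : 0 ≤ t) (hU : U t < ∞) :
    (U t).toReal = Real.exp (-t) *
      (c + ∫ σ in (0 : ℝ)..t, Real.exp σ * (U (α * σ)).toReal ^ 2) := by
  have hfin := (h.lintegral_lt_top ht hU).ne
  have h1 := integral_toReal h.measurable_integrand.aemeasurable
    (ae_lt_top h.measurable_integrand hfin)
  simp only [ENNReal.toReal_mul, ENNReal.toReal_pow,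
    ENNReal.toReal_ofReal (Real.exp_pos _).le] at h1
  rw [intervalIntegral.integral_of_le ht, h1, h.eq t ht, ENNReal.toReal_mul,
    ENNReal.toReal_ofReal (Real.exp_pos _).le, ENNReal.toReal_add ENNReal.coe_ne_top hfin,
    ENNReal.coe_toReal]

theorem continuousOn_toReal (h : IsExtendedRiccatiSolution α c U) {r : ℝ} (hr : 0 ≤ r)
    (hU : U r < ∞) : ContinuousOn (fun t => (U t).toReal) (Icc 0 r) := by
  have hint : IntegrableOn (fun σ => Real.exp σ * (U (α * σ)).toReal ^ 2) (uIcc 0 r) := by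
    rw [uIcc_of_le hr, integrableOn_Icc_iff_integrableOn_Ioc,
      ← intervalIntegrable_iff_integrableOn_Ioc_of_le hr]
    exact h.intervalIntegrable hr hU
  have hc := intervalIntegral.continuousOn_primitive_interval hint
  rw [uIcc_of_le hr] at hc
  refine ContinuousOn.congr (f := fun t => Real.exp (-t) *
      (c + ∫ σ in (0 : ℝ)..t, Real.exp σ * (U (α * σ)).toReal ^ 2))
    (ContinuousOn.mul (by fun_prop) (continuousOn_const.add hc)) fun t ht => ?_
  exact h.toReal_eq ht.1 (h.lt_top_of_le ht.1 ht.2 hU)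

theorem isAlphaRiccatiSolutionOn_Icc (h : IsExtendedRiccatiSolution α c U) (hα : 0 ≤ α) {r : ℝ}
    (hr : 0 ≤ r) (hU : U r < ∞) :
    IsAlphaRiccatiSolutionOn α c (Icc 0 r) (fun t => (U t).toReal) := by
  have hfin : ∀ t ∈ Icc 0 r, U t < ∞ := fun t ht => h.lt_top_of_le ht.1 ht.2 hU
  have hg : ContinuousOn (fun σ => Real.exp σ * (U (α * σ)).toReal ^ 2) (Icc 0 r) := by
    refine ContinuousOn.mul (by fun_prop) (ContinuousOn.pow ?_ 2)
    refine (h.continuousOn_toReal (by positivity) (h.lt_top_scale hα hr hU)).comp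
      (by fun_prop) fun σ hσ => ?_
    exact ⟨mul_nonneg hα hσ.1, mul_le_mul_of_nonneg_left hσ.2 hα⟩
  refine ⟨?_, h.continuousOn_toReal hr hU, fun t ht => ?_, fun t ht => ?_, fun t ht => ?_⟩
  · simpa using h.toReal_eq le_rfl (hfin 0 ⟨le_rfl, hr⟩)
  · have : Fact (t ∈ Icc 0 r) := ⟨ht⟩
    have hd := intervalIntegral.integral_hasDerivWithinAt_right
      (h.intervalIntegrable ht.1 (hfin t ht)) (s := Icc 0 r) (t := Icc 0 r)
      (hg.stronglyMeasurableAtFilter_nhdsWithin measurableSet_Icc t) (hg t ht)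
    have he : HasDerivWithinAt (fun t => Real.exp (-t)) (Real.exp (-t) * -1) (Icc 0 r) t :=
      ((hasDerivAt_neg t).exp).hasDerivWithinAt
    have hp := he.mul (hd.const_add (c : ℝ))
    refine (hp.congr (fun s hs => ?_) ?_).congr_deriv ?_
    · exact h.toReal_eq hs.1 (hfin s hs)
    · exact h.toReal_eq ht.1 (hfin t ht)
    · rw [h.toReal_eq ht.1 (hfin t ht), ← mul_assoc, ← Real.exp_add]
      simp
  · have hi := ((h.intervalIntegrable ht.1 (hfin t ht)).const_mul (Real.exp (-t))).comp_sub_left t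
    have heq : (fun s => Real.exp (-t) * (Real.exp (t - s) * (U (α * (t - s))).toReal ^ 2)) =
        fun s => Real.exp (-s) * (U (α * (t - s))).toReal ^ 2 := by
      funext s
      rw [← mul_assoc, ← Real.exp_add]
      ring_nf
    rw [heq] at hi
    simpa using hi.symm
  · have hi := intervalIntegral.integral_comp_sub_left (a := 0) (b := t)
      (fun σ => Real.exp (-t) * (Real.exp σ * (U (α * σ)).toReal ^ 2)) t
    have heq : (fun s => Real.exp (-t) * (Real.exp (t - s) * (U (α * (t - s))).toReal ^ 2)) =
        fun s => Real.exp (-s) * (U (α * (t - s))).toReal ^ 2 := by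
      funext s
      rw [← mul_assoc, ← Real.exp_add]
      ring_nf
    rw [heq, sub_self, sub_zero, intervalIntegral.integral_const_mul] at hi
    rw [hi, h.toReal_eq ht.1 (hfin t ht)]
    ring

theorem isAlphaRiccatiSolutionOn_Ici (h : IsExtendedRiccatiSolution α c U) (hα : 0 ≤ α)
    (hU : ∀ t, 0 ≤ t → U t < ∞) :
    IsAlphaRiccatiSolutionOn α c (Ici 0) (fun t => (U t).toReal) := by
  have hI : ∀ t, 0 ≤ t → IsAlphaRiccatiSolutionOn α c (Icc 0 (t + 1)) (fun t => (U t).toReal) :=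
    fun t ht => h.isAlphaRiccatiSolutionOn_Icc hα (by positivity) (hU _ (by positivity))
  have hmem : ∀ t : ℝ, 0 ≤ t → t ∈ Icc 0 (t + 1) := fun t ht => ⟨ht, by linarith⟩
  have hd : ∀ t ∈ Ici (0 : ℝ), HasDerivWithinAt (fun t => (U t).toReal)
      (-(U t).toReal + (U (α * t)).toReal ^ 2) (Ici 0) t := by
    intro t ht
    refine ((hI t ht).hasDeriv t (hmem t ht)).mono_of_mem_nhdsWithin ?_
    rw [← Ici_inter_Iic]
    exact inter_mem_nhdsWithin _ (Iic_mem_nhds (by linarith))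
  exact ⟨(hI 0 le_rfl).initial, fun t ht => (hd t ht).continuousWithinAt, hd,
    fun t ht => (hI t ht).integrable t (hmem t ht), fun t ht => (hI t ht).mild t (hmem t ht)⟩

end IsExtendedRiccatiSolution

/-! ### Scaling and Tonelli for the time integrals -/

theorem setLIntegral_comp_const_mul {α : ℝ} (hα : 0 < α) {s : Set ℝ} (hs : MeasurableSet s)
    {f : ℝ → ℝ≥0∞} (hf : Measurable f) :
    ∫⁻ σ in (α * ·) ⁻¹' s, f (α * σ) = ENNReal.ofReal α⁻¹ * ∫⁻ x in s, f x := by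
  rw [← setLIntegral_map hs hf (measurable_const_mul α), Real.map_volume_mul_left hα.ne',
    Measure.restrict_smul, lintegral_smul_measure, abs_of_pos (inv_pos.2 hα), smul_eq_mul]

theorem lintegral_exp_neg_mul_lintegral {A : Set ℝ} {k : ℝ → ℝ≥0∞} (hk : Measurable k) :
    ∫⁻ t in A, ENNReal.ofReal (Real.exp (-t)) *
        ∫⁻ σ in Ioc 0 t, ENNReal.ofReal (Real.exp σ) * k σ
      = ∫⁻ σ in Ioi 0, k σ * (ENNReal.ofReal (Real.exp σ) *
          ∫⁻ t in A, (Ici σ).indicator (fun t => ENNReal.ofReal (Real.exp (-t))) t) := by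
  have hmeas : Measurable fun q : ℝ × ℝ => {q : ℝ × ℝ | q.2 ≤ q.1}.indicator
      (fun q => ENNReal.ofReal (Real.exp (-q.1)) * (ENNReal.ofReal (Real.exp q.2) * k q.2)) q :=
    Measurable.indicator (by fun_prop) (measurableSet_le measurable_snd measurable_fst)
  have h1 : ∀ t : ℝ, ENNReal.ofReal (Real.exp (-t)) *
        ∫⁻ σ in Ioc 0 t, ENNReal.ofReal (Real.exp σ) * k σ
      = ∫⁻ σ in Ioi 0, {q : ℝ × ℝ | q.2 ≤ q.1}.indicator (fun q =>
          ENNReal.ofReal (Real.exp (-q.1)) * (ENNReal.ofReal (Real.exp q.2) * k q.2)) (t, σ) := by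
    intro t
    rw [← lintegral_const_mul _ (by fun_prop), ← Ioi_inter_Iic, inter_comm,
      ← Measure.restrict_restrict measurableSet_Iic, ← lintegral_indicator measurableSet_Iic]
    rfl
  simp_rw [h1]
  rw [lintegral_lintegral_swap hmeas.aemeasurable]
  refine lintegral_congr fun σ => ?_
  rw [← mul_assoc, ← lintegral_const_mul _ (Measurable.indicator (by fun_prop) measurableSet_Ici)]
  refine lintegral_congr fun t => ?_
  by_cases h : σ ≤ t
  · simp only [indicator, mem_ofPred_eq, h, if_true, mem_Ici]
    ring
  · simp [indicator, h]

theorem lintegral_Ioi_exp_neg_mul_lintegral {k : ℝ → ℝ≥0∞} (hk : Measurable k) :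
    ∫⁻ t in Ioi 0, ENNReal.ofReal (Real.exp (-t)) *
        ∫⁻ σ in Ioc 0 t, ENNReal.ofReal (Real.exp σ) * k σ
      = ∫⁻ σ in Ioi 0, k σ := by
  rw [lintegral_exp_neg_mul_lintegral hk]
  refine setLIntegral_congr_fun measurableSet_Ioi fun σ hσ => ?_
  have hsub : Ici σ ∩ Ioi 0 = Ici σ := inter_eq_left.2 (Ici_subset_Ioi.2 hσ)
  have : ∫⁻ t in Ici σ, ENNReal.ofReal (Real.exp (-t)) = ENNReal.ofReal (Real.exp (-σ)) := by
    rw [setLIntegral_congr Ioi_ae_eq_Ici.symm, ← ofReal_integral_eq_lintegral_ofReal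
      (integrableOn_exp_neg_Ioi σ) (Eventually.of_forall fun x => (Real.exp_pos _).le),
      integral_exp_neg_Ioi]
  rw [lintegral_indicator measurableSet_Ici, Measure.restrict_restrict measurableSet_Ici, hsub,
    this, ← ENNReal.ofReal_mul (Real.exp_pos _).le, ← Real.exp_add]
  simp

/-! ### The branching recursion for probabilities of events -/

theorem measure_prod_or_add_sq (A : Set (TreeVertex → ℝ)) (hA : MeasurableSet A) :
    (clockLaw.prod clockLaw) {p | p.1 ∈ A ∨ p.2 ∈ A} + clockLaw A ^ 2 = 2 * clockLaw A := by
  have hu : {p : (TreeVertex → ℝ) × (TreeVertex → ℝ) | p.1 ∈ A ∨ p.2 ∈ A}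
      = A ×ˢ univ ∪ univ ×ˢ A := by
    ext p; simp
  have hi : A ×ˢ A = (A ×ˢ (univ : Set (TreeVertex → ℝ))) ∩ (univ ×ˢ A) := by
    ext p; simp
  rw [hu, sq, ← Measure.prod_prod, hi, measure_union_add_inter _ (MeasurableSet.univ.prod hA)]
  simp [two_mul]

/-- Let `A'` be the event that, if the root clock exceeds `t`, holds according to `C`, and that
otherwise is the occurrence of `A` in at least one of the two subtrees. The probability of `A'`
obtained by conditioning on the root clock. -/
theorem measure_branching (α : ℝ) {A A' : Set ((TreeVertex → ℝ) × ℝ)} (hA : MeasurableSet A)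
    (hm : MeasurableSet A') (C : Prop) [Decidable C]
    (h : ∀ τ t, (τ, t) ∈ A' ↔ if t < τ [] then C else
      (subtreeClocks 0 τ, α * (t - τ [])) ∈ A ∨ (subtreeClocks 1 τ, α * (t - τ [])) ∈ A)
    {t : ℝ} (ht : 0 ≤ t) :
    clockLaw {τ | (τ, t) ∈ A'} = ENNReal.ofReal (Real.exp (-t)) * ((if C then 1 else 0) +
      ∫⁻ σ in Ioc 0 t, ENNReal.ofReal (Real.exp σ) *
        (clockLaw.prod clockLaw) {p | (p.1, α * σ) ∈ A ∨ (p.2, α * σ) ∈ A}) := by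
  set B : Set ((TreeVertex → ℝ) × (TreeVertex → ℝ) × ℝ) :=
    {p | (p.1, p.2.2) ∈ A ∨ (p.2.1, p.2.2) ∈ A}
  have hB : MeasurableSet B := by
    have h1 : Measurable fun p : (TreeVertex → ℝ) × (TreeVertex → ℝ) × ℝ => (p.1, p.2.2) := by
      fun_prop
    have h2 : Measurable fun p : (TreeVertex → ℝ) × (TreeVertex → ℝ) × ℝ => (p.2.1, p.2.2) := by
      fun_prop
    exact (h1 hA).union (h2 hA)
  have hK := lintegral_clockLaw_ite α ht (if C then 1 else 0)
    (K := fun a b s => B.indicator 1 (a, b, s)) (measurable_one.indicator hB)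
  have hsec : MeasurableSet {τ : TreeVertex → ℝ | (τ, t) ∈ A'} := measurable_prodMk_right hm
  rw [← lintegral_indicator_one hsec]
  convert hK using 1
  · refine lintegral_congr fun τ => ?_
    have := h τ t
    by_cases h1 : t < τ []
    · simp only [h1, if_true] at this
      simp [indicator, this, h1]
    · simp only [h1, if_false] at this
      rw [if_neg h1]
      by_cases h2 : (τ, t) ∈ A'
      · have h3 : (subtreeClocks 0 τ, subtreeClocks 1 τ, α * (t - τ [])) ∈ B := this.1 h2
        rw [indicator_of_mem h3, indicator_of_mem (by exact h2)]
        rfl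
      · have h3 : (subtreeClocks 0 τ, subtreeClocks 1 τ, α * (t - τ [])) ∉ B :=
          fun h3 => h2 (this.2 h3)
        rw [indicator_of_notMem h3, indicator_of_notMem (by exact h2)]
  · congr 3
    funext σ
    congr 1
    have hsec' : MeasurableSet {p : (TreeVertex → ℝ) × (TreeVertex → ℝ) |
        (p.1, α * σ) ∈ A ∨ (p.2, α * σ) ∈ A} := by
      have h1 : Measurable fun p : (TreeVertex → ℝ) × (TreeVertex → ℝ) => (p.1, p.2, α * σ) := by
        fun_prop
      exact h1 hB
    rw [← lintegral_indicator_one hsec']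
    rfl

/-! ### Almost sure finiteness of the limit outside `1 < α < 2` -/

/-- The set of clocks and times for which the limit started from `1` is infinite. -/
def blowupSet (α : ℝ) (u₀ : ℝ≥0) : Set ((TreeVertex → ℝ) × ℝ) :=
  {q | riccatiLimit α u₀ 1 q.1 q.2 = ∞}

/-- The probability that the limit started from `1` is infinite at time `t`. -/
noncomputable def blowupProb (α : ℝ) (u₀ : ℝ≥0) (t : ℝ) : ℝ≥0∞ :=
  clockLaw {τ | (τ, t) ∈ blowupSet α u₀}

/-- The probability that the two independent copies of the limit are not both finite. -/
noncomputable def pairBlowupProb (α : ℝ) (u₀ : ℝ≥0) (t : ℝ) : ℝ≥0∞ :=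
  (clockLaw.prod clockLaw) {p | (p.1, t) ∈ blowupSet α u₀ ∨ (p.2, t) ∈ blowupSet α u₀}

/-- The set of clocks and times for which the `n`-th iterate differs from its initial value `1`;
for `u₀ > 1` this means that some vertex of depth less than `n` is alive at time `t`, its clock
still running. -/
def leafSet (α : ℝ) (u₀ : ℝ≥0) (n : ℕ) : Set ((TreeVertex → ℝ) × ℝ) :=
  {q | riccatiIter α u₀ 1 n q.1 q.2 ≠ 1}

theorem measurableSet_blowupSet (α : ℝ) (u₀ : ℝ≥0) : MeasurableSet (blowupSet α u₀) :=
  measurable_riccatiLimit α u₀ 1 (measurableSet_singleton ∞)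

theorem measurableSet_leafSet (α : ℝ) (u₀ : ℝ≥0) (n : ℕ) : MeasurableSet (leafSet α u₀ n) :=
  (measurable_riccatiIter α u₀ 1 n (measurableSet_singleton 1)).compl

theorem measurable_blowupProb (α : ℝ) (u₀ : ℝ≥0) : Measurable (blowupProb α u₀) :=
  measurable_measure_prodMk_right (measurableSet_blowupSet α u₀)

theorem measurable_pairBlowupProb (α : ℝ) (u₀ : ℝ≥0) : Measurable (pairBlowupProb α u₀) := by
  have h1 : Measurable fun q : ((TreeVertex → ℝ) × (TreeVertex → ℝ)) × ℝ => (q.1.1, q.2) := by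
    fun_prop
  have h2 : Measurable fun q : ((TreeVertex → ℝ) × (TreeVertex → ℝ)) × ℝ => (q.1.2, q.2) := by
    fun_prop
  exact measurable_measure_prodMk_right ((h1 (measurableSet_blowupSet α u₀)).union
    (h2 (measurableSet_blowupSet α u₀)))

theorem pairBlowupProb_add_sq (α : ℝ) (u₀ : ℝ≥0) (t : ℝ) :
    pairBlowupProb α u₀ t + blowupProb α u₀ t ^ 2 = 2 * blowupProb α u₀ t :=
  measure_prod_or_add_sq _ (measurable_prodMk_right (measurableSet_blowupSet α u₀))

theorem pairBlowupProb_le (α : ℝ) (u₀ : ℝ≥0) (t : ℝ) :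
    pairBlowupProb α u₀ t ≤ 2 * blowupProb α u₀ t :=
  le_self_add.trans_eq (pairBlowupProb_add_sq α u₀ t)

theorem blowupProb_eq (α : ℝ) {u₀ : ℝ≥0} (hu : 1 ≤ u₀) {t : ℝ} (ht : 0 ≤ t) :
    blowupProb α u₀ t = ENNReal.ofReal (Real.exp (-t)) *
      ∫⁻ σ in Ioc 0 t, ENNReal.ofReal (Real.exp σ) * pairBlowupProb α u₀ (α * σ) := by
  have h := measure_branching α (measurableSet_blowupSet α u₀) (measurableSet_blowupSet α u₀) False
    (fun τ t => by
      simp only [blowupSet, mem_ofPred_eq]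
      rw [riccatiLimit_eq_ite (Or.inr rfl)]
      split_ifs with h
      · simp
      · have hne : ∀ a s, riccatiLimit α u₀ 1 a s ≠ 0 :=
          fun a s => (one_pos.trans_le (one_le_riccatiLimit hu a s)).ne'
        simp [ENNReal.mul_eq_top, hne, or_comm]) ht
  simpa only [if_false, zero_add] using! h

theorem measure_leafSet_succ (α : ℝ) {u₀ : ℝ≥0} (hu : 1 < u₀) (n : ℕ) {t : ℝ} (ht : 0 ≤ t) :
    clockLaw {τ | (τ, t) ∈ leafSet α u₀ (n + 1)} = ENNReal.ofReal (Real.exp (-t)) * (1 +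
      ∫⁻ σ in Ioc 0 t, ENNReal.ofReal (Real.exp σ) * (clockLaw.prod clockLaw)
        {p | (p.1, α * σ) ∈ leafSet α u₀ n ∨ (p.2, α * σ) ∈ leafSet α u₀ n}) := by
  have h := measure_branching α (measurableSet_leafSet α u₀ n) (measurableSet_leafSet α u₀ (n + 1))
    True (fun τ t => by
      simp only [leafSet, mem_ofPred_eq]
      rcases lt_or_ge t (τ []) with h | h
      · simp [riccatiIter_succ_of_lt h, h, hu.ne']
      · have := mul_eq_one_iff_of_one_le
          (one_le_riccatiIter (α := α) hu.le le_rfl n (subtreeClocks 0 τ) (α * (t - τ [])))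
          (one_le_riccatiIter (α := α) hu.le le_rfl n (subtreeClocks 1 τ) (α * (t - τ [])))
        rw [riccatiIter_succ_of_le h, if_neg (not_lt.2 h), Ne, this]
        tauto) ht
  simpa only [if_true] using! h

/-- For `α ≤ 1` the rescaled time never grows, and the linear bound `2 p` for the branching
recursion of the blow-up probability `p` forces it to vanish by Gronwall's argument. -/
theorem blowupProb_eq_zero_of_le_one {α : ℝ} (hα : 0 ≤ α) (hα1 : α ≤ 1) {u₀ : ℝ≥0} (hu : 1 ≤ u₀)
    {t : ℝ} (ht : 0 ≤ t) : blowupProb α u₀ t = 0 := by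
  -- integrating `2 exp (4 σ)` gives at most `exp (4 t) / 2`: each step gains a factor `1 / 2`
  have key : ∀ n : ℕ, ∀ t, 0 ≤ t →
      blowupProb α u₀ t ≤ ENNReal.ofReal (Real.exp (4 * t) * (1 / 2) ^ n) := by
    intro n
    induction n with
    | zero =>
      intro t ht
      refine prob_le_one.trans ?_
      simpa using ht
    | succ n ih =>
      intro t ht
      have hpt : ∀ σ ∈ Ioc 0 t, ENNReal.ofReal (Real.exp σ) * pairBlowupProb α u₀ (α * σ) ≤
          ENNReal.ofReal (Real.exp t * (2 * (1 / 2) ^ n) * Real.exp (4 * σ)) := by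
        intro σ hσ
        have h1 : pairBlowupProb α u₀ (α * σ) ≤
            ENNReal.ofReal (2 * (Real.exp (4 * σ) * (1 / 2) ^ n)) := by
          refine (pairBlowupProb_le _ _ _).trans ?_
          rw [ENNReal.ofReal_mul zero_le_two, ENNReal.ofReal_ofNat]
          gcongr
          refine (ih _ (mul_nonneg hα hσ.1.le)).trans (ENNReal.ofReal_le_ofReal ?_)
          gcongr
          exact mul_le_of_le_one_left hσ.1.le hα1
        calc _ ≤ ENNReal.ofReal (Real.exp t) *
              ENNReal.ofReal (2 * (Real.exp (4 * σ) * (1 / 2) ^ n)) := by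
              gcongr
              exact hσ.2
          _ = _ := by
              rw [← ENNReal.ofReal_mul (Real.exp_pos _).le]
              congr 1
              ring
      have hint : ∫ σ in (0 : ℝ)..t, Real.exp (4 * σ) = (Real.exp (4 * t) - 1) / 4 := by
        rw [intervalIntegral.integral_comp_mul_left (fun x => Real.exp x) (by norm_num), integral_exp]
        simp
        ring
      rw [blowupProb_eq α hu ht]
      calc _ ≤ ENNReal.ofReal (Real.exp (-t)) * ∫⁻ σ in Ioc 0 t,
            ENNReal.ofReal (Real.exp t * (2 * (1 / 2) ^ n) * Real.exp (4 * σ)) :=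
            mul_le_mul_right (setLIntegral_mono (by fun_prop) hpt) _
        _ = ENNReal.ofReal (Real.exp (-t) *
            (Real.exp t * (2 * (1 / 2) ^ n) * ((Real.exp (4 * t) - 1) / 4))) := by
            rw [← ofReal_integral_eq_lintegral_ofReal, ← intervalIntegral.integral_of_le ht,
              intervalIntegral.integral_const_mul, hint, ENNReal.ofReal_mul (Real.exp_pos _).le]
            · exact ((by fun_prop : Continuous fun σ =>
                Real.exp t * (2 * (1 / 2) ^ n) * Real.exp (4 * σ)).integrableOn_Icc).mono_set
                Ioc_subset_Icc_self
            · exact Eventually.of_forall fun σ => by positivity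
        _ ≤ _ := by
            refine ENNReal.ofReal_le_ofReal ?_
            rw [← mul_assoc, ← mul_assoc, ← Real.exp_add, neg_add_cancel, Real.exp_zero, one_mul,
              pow_succ]
            have : (0 : ℝ) < (1 / 2) ^ n := by positivity
            nlinarith
  have hlim : Tendsto (fun n : ℕ => ENNReal.ofReal (Real.exp (4 * t) * (1 / 2) ^ n)) atTop (𝓝 0) := by
    have := (tendsto_pow_atTop_nhds_zero_of_lt_one (r := (1 / 2 : ℝ)) (by norm_num)
      (by norm_num)).const_mul (Real.exp (4 * t))
    simpa using ENNReal.tendsto_ofReal this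
  exact le_antisymm (ge_of_tendsto' hlim fun n => key n t ht) zero_le

theorem lintegral_Ioc_ofReal_exp {a b : ℝ} (hab : a ≤ b) :
    ∫⁻ σ in Ioc a b, ENNReal.ofReal (Real.exp σ) = ENNReal.ofReal (Real.exp b - Real.exp a) := by
  rw [← ofReal_integral_eq_lintegral_ofReal, ← intervalIntegral.integral_of_le hab, integral_exp]
  · exact (Real.continuous_exp.integrableOn_Icc).mono_set Ioc_subset_Icc_self
  · exact Eventually.of_forall fun σ => (Real.exp_pos _).le

theorem lintegral_Ioi_ofReal_exp_neg (a : ℝ) :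
    ∫⁻ σ in Ioi a, ENNReal.ofReal (Real.exp (-σ)) = ENNReal.ofReal (Real.exp (-a)) := by
  rw [← ofReal_integral_eq_lintegral_ofReal (integrableOn_exp_neg_Ioi a)
    (Eventually.of_forall fun x => (Real.exp_pos _).le), integral_exp_neg_Ioi]

/-- For `α ≥ 2` leaves are exponentially unlikely at late times: the function equal to `1` on
`[0, 2 log 4]` and to `8 exp (-t)` afterwards is a supersolution of the recursion for the
probability of a leaf. -/
theorem measure_leafSet_le {α : ℝ} (hα : 2 ≤ α) {u₀ : ℝ≥0} (hu : 1 < u₀) (n : ℕ) :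
    ∀ t, 2 * Real.log 4 < t →
      clockLaw {τ | (τ, t) ∈ leafSet α u₀ n} ≤ ENNReal.ofReal (8 * Real.exp (-t)) := by
  have hl : 0 < Real.log 4 := Real.log_pos (by norm_num)
  have he : Real.exp (Real.log 4) = 4 := Real.exp_log (by norm_num)
  induction n with
  | zero => intro t _; simp [leafSet, riccatiIter]
  | succ n ih =>
    intro t ht
    set L := Real.log 4
    rw [measure_leafSet_succ α hu n (by linarith)]
    set G : ℝ → ℝ≥0∞ := fun s => (clockLaw.prod clockLaw)
        {p | (p.1, s) ∈ leafSet α u₀ n ∨ (p.2, s) ∈ leafSet α u₀ n} with hG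
    -- times `σ ≤ log 4`, where only the trivial bound `1` for the pair is available
    have hearly : ∫⁻ σ in Ioc 0 L, ENNReal.ofReal (Real.exp σ) * G (α * σ) ≤ ENNReal.ofReal 3 := by
      calc _ ≤ ∫⁻ σ in Ioc 0 L, ENNReal.ofReal (Real.exp σ) :=
            lintegral_mono fun σ => mul_le_of_le_one_right' prob_le_one
        _ = _ := by
            rw [lintegral_Ioc_ofReal_exp hl.le, he, Real.exp_zero]
            norm_num
    -- times `σ > log 4`, for which `α σ > 2 log 4` and the induction hypothesis applies
    have hlate : ∫⁻ σ in Ioc L t, ENNReal.ofReal (Real.exp σ) * G (α * σ) ≤ ENNReal.ofReal 4 := by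
      have hpt : ∀ σ ∈ Ioc L t, ENNReal.ofReal (Real.exp σ) * G (α * σ) ≤
          ENNReal.ofReal 16 * ENNReal.ofReal (Real.exp (-σ)) := by
        intro σ hσ
        have h2 : 2 * σ ≤ α * σ := mul_le_mul_of_nonneg_right hα (by linarith [hσ.1])
        have hsec : MeasurableSet {τ : TreeVertex → ℝ | (τ, α * σ) ∈ leafSet α u₀ n} :=
          measurable_prodMk_right (measurableSet_leafSet α u₀ n)
        have h1 : G (α * σ) ≤ 2 * ENNReal.ofReal (8 * Real.exp (-(2 * σ))) := by
          refine (le_self_add.trans_eq (measure_prod_or_add_sq _ hsec)).trans ?_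
          gcongr
          refine (ih _ (by linarith [hσ.1])).trans (ENNReal.ofReal_le_ofReal ?_)
          gcongr
        calc _ ≤ ENNReal.ofReal (Real.exp σ) * (2 * ENNReal.ofReal (8 * Real.exp (-(2 * σ)))) := by
              gcongr
          _ = _ := by
              rw [← ENNReal.ofReal_ofNat 2, ← ENNReal.ofReal_mul zero_le_two,
                ← ENNReal.ofReal_mul (Real.exp_pos _).le, ← ENNReal.ofReal_mul (by norm_num)]
              congr 1
              have : Real.exp (-σ) = Real.exp σ * Real.exp (-(2 * σ)) := by
                rw [← Real.exp_add]; ring_nf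
              rw [this]
              ring
      calc _ ≤ ∫⁻ σ in Ioc L t, ENNReal.ofReal 16 * ENNReal.ofReal (Real.exp (-σ)) :=
            setLIntegral_mono (by fun_prop) hpt
        _ ≤ ∫⁻ σ in Ioi L, ENNReal.ofReal 16 * ENNReal.ofReal (Real.exp (-σ)) :=
            lintegral_mono_set Ioc_subset_Ioi_self
        _ = _ := by
            rw [lintegral_const_mul _ (by fun_prop), lintegral_Ioi_ofReal_exp_neg,
              ← ENNReal.ofReal_mul (by norm_num), Real.exp_neg, he]
            norm_num
    -- together with the `1` from the root, `1 + 3 + 4 = 8` reproduces the constant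
    have hsplit : ∫⁻ σ in Ioc 0 t, ENNReal.ofReal (Real.exp σ) * G (α * σ) ≤ ENNReal.ofReal 7 := by
      rw [← Ioc_union_Ioc_eq_Ioc hl.le (by linarith : L ≤ t)]
      refine (lintegral_union_le _ _ _).trans ((add_le_add hearly hlate).trans_eq ?_)
      rw [← ENNReal.ofReal_add (by norm_num) (by norm_num)]
      norm_num
    rw [mul_comm 8, ENNReal.ofReal_mul (Real.exp_pos _).le]
    gcongr
    refine (add_le_add_right hsplit 1).trans_eq ?_
    rw [← ENNReal.ofReal_one, ← ENNReal.ofReal_add (by norm_num) (by norm_num)]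
    norm_num

theorem blowupProb_le_exp_neg {α : ℝ} (hα : 2 ≤ α) {u₀ : ℝ≥0} (hu : 1 < u₀) {t : ℝ}
    (ht : 2 * Real.log 4 < t) : blowupProb α u₀ t ≤ ENNReal.ofReal (8 * Real.exp (-t)) := by
  have hsub : {τ | (τ, t) ∈ blowupSet α u₀} ⊆ ⋃ n, {τ | (τ, t) ∈ leafSet α u₀ n} := by
    intro τ hτ
    by_contra hcon
    simp only [leafSet, mem_iUnion, mem_ofPred_eq, not_exists, not_not] at hcon
    simp [blowupSet, riccatiLimit, hcon] at hτ
  have hmono : Monotone fun n => {τ | (τ, t) ∈ leafSet α u₀ n} := by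
    refine monotone_nat_of_le_succ fun n τ hτ => ?_
    have h1 : 1 < riccatiIter α u₀ 1 n τ t :=
      lt_of_le_of_ne (one_le_riccatiIter hu.le le_rfl n τ t) (Ne.symm hτ)
    exact (h1.trans_le (riccatiIter_le_succ hu.le (by simp) n τ t)).ne'
  refine (measure_mono hsub).trans ?_
  rw [hmono.measure_iUnion]
  exact iSup_le fun n => measure_leafSet_le hα hu n t ht

/-- For `α ≥ 2` integrating the recursion for the blow-up probability `p` over all times gives
`∫ p + ∫ p (α t) ^ 2 dt = (2 / α) ∫ p ≤ ∫ p < ∞`, so that `p` vanishes. -/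
theorem blowupProb_eq_zero_of_two_le {α : ℝ} (hα : 2 ≤ α) {u₀ : ℝ≥0} (hu : 1 < u₀) {t : ℝ}
    (ht : 0 ≤ t) : blowupProb α u₀ t = 0 := by
  set p := blowupProb α u₀ with hp
  set g := pairBlowupProb α u₀
  have hα0 : 0 < α := by linarith
  have hpm : Measurable p := measurable_blowupProb α u₀
  have hgm : Measurable g := measurable_pairBlowupProb α u₀
  have hl : 0 < Real.log 4 := Real.log_pos (by norm_num)
  have hfin : ∫⁻ s in Ioi 0, p s ≠ ∞ := by
    rw [← Ioc_union_Ioi_eq_Ioi (by linarith : 0 ≤ 2 * Real.log 4)]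
    refine ((lintegral_union_le _ _ _).trans_lt (ENNReal.add_lt_top.2 ⟨?_, ?_⟩)).ne
    · calc _ ≤ ∫⁻ s in Ioc 0 (2 * Real.log 4), 1 := lintegral_mono fun s => prob_le_one
        _ < ∞ := by simpa using ENNReal.mul_lt_top ENNReal.ofNat_lt_top ENNReal.ofReal_lt_top
    · calc _ ≤ ∫⁻ s in Ioi (2 * Real.log 4), ENNReal.ofReal 8 * ENNReal.ofReal (Real.exp (-s)) :=
            setLIntegral_mono (by fun_prop) fun s hs =>
              (blowupProb_le_exp_neg hα hu hs).trans_eq (ENNReal.ofReal_mul (by norm_num))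
        _ < ∞ := by
            rw [lintegral_const_mul _ (by fun_prop), lintegral_Ioi_ofReal_exp_neg]
            exact ENNReal.mul_lt_top ENNReal.ofReal_lt_top ENNReal.ofReal_lt_top
  have hpg : ∫⁻ s in Ioi 0, p s = ∫⁻ σ in Ioi 0, g (α * σ) := by
    rw [← lintegral_Ioi_exp_neg_mul_lintegral (by fun_prop : Measurable fun σ => g (α * σ))]
    exact setLIntegral_congr_fun measurableSet_Ioi fun s hs => blowupProb_eq α hu.le (mem_Ioi.1 hs).le
  have hsum : (∫⁻ σ in Ioi 0, g (α * σ)) + ∫⁻ σ in Ioi 0, p (α * σ) ^ 2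
      = ∫⁻ σ in Ioi 0, 2 * p (α * σ) := by
    rw [← lintegral_add_left (by fun_prop)]
    exact lintegral_congr fun σ => pairBlowupProb_add_sq α u₀ (α * σ)
  have hpre : (α * ·) ⁻¹' Ioi (0 : ℝ) = Ioi 0 := by
    ext x; simp [hα0]
  have hscale : ∫⁻ σ in Ioi 0, 2 * p (α * σ) ≤ ∫⁻ s in Ioi 0, p s := by
    have h := setLIntegral_comp_const_mul hα0 measurableSet_Ioi (s := Ioi 0) hpm
    rw [hpre] at h
    rw [lintegral_const_mul _ (by fun_prop), h, ← mul_assoc]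
    refine mul_le_of_le_one_left' ?_
    rw [← ENNReal.ofReal_ofNat 2, ← ENNReal.ofReal_mul zero_le_two, ENNReal.ofReal_le_one,
      ← div_eq_mul_inv, div_le_one hα0]
    exact hα
  have hsq : ∫⁻ σ in Ioi 0, p (α * σ) ^ 2 = 0 := by
    rw [← hsum, ← hpg] at hscale
    have h : (∫⁻ s in Ioi 0, p s) + ∫⁻ σ in Ioi 0, p (α * σ) ^ 2 ≤ (∫⁻ s in Ioi 0, p s) + 0 := by
      simpa using hscale
    exact le_antisymm ((ENNReal.add_le_add_iff_left hfin).1 h) zero_le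
  have hae : ∀ᵐ σ ∂(volume.restrict (Ioi (0 : ℝ))), p (α * σ) = 0 := by
    filter_upwards [(lintegral_eq_zero_iff (by fun_prop)).1 hsq] with σ hσ
    simpa using hσ
  have hzero : ∫⁻ σ in Ioc 0 t, ENNReal.ofReal (Real.exp σ) * g (α * σ) = 0 := by
    rw [lintegral_eq_zero_iff (by fun_prop)]
    filter_upwards [ae_mono (Measure.restrict_mono_set volume Ioc_subset_Ioi_self) hae] with σ hσ
    have : g (α * σ) ≤ 0 := by simpa [← hp, hσ] using pairBlowupProb_le α u₀ (α * σ)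
    rw [le_antisymm this zero_le, mul_zero, Pi.zero_apply]
  rw [hp, blowupProb_eq α hu.le ht, hzero, mul_zero]

theorem ae_riccatiLimit_one_lt_top {α : ℝ} (hα : 0 ≤ α) (h : α ≤ 1 ∨ 2 ≤ α) (u₀ : ℝ≥0) {t : ℝ}
    (ht : 0 ≤ t) : ∀ᵐ τ ∂clockLaw, riccatiLimit α u₀ 1 τ t < ∞ := by
  rcases le_or_gt u₀ 1 with hu | hu
  · exact Eventually.of_forall fun τ =>
      (riccatiLimit_le_one hu le_rfl τ t).trans_lt ENNReal.one_lt_top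
  · have h0 : blowupProb α u₀ t = 0 := by
      rcases h with h | h
      · exact blowupProb_eq_zero_of_le_one hα h hu.le ht
      · exact blowupProb_eq_zero_of_two_le h hu ht
    simpa only [ae_iff, not_lt, top_le_iff] using! h0

/-! ### Infinite mean for `1 < α < 2` and `u₀ > 1` -/

theorem one_le_limitMean {α : ℝ} {u₀ : ℝ≥0} (hu : 1 ≤ u₀) (t : ℝ) : 1 ≤ limitMean α u₀ 1 t := by
  calc (1 : ℝ≥0∞) = ∫⁻ _, 1 ∂clockLaw := by simp
    _ ≤ _ := lintegral_mono fun τ => one_le_riccatiLimit hu τ t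

theorem limitMean_le_one {α : ℝ} {u₀ x₀ : ℝ≥0} (hu : u₀ ≤ 1) (hx : x₀ ≤ 1) (t : ℝ) :
    limitMean α u₀ x₀ t ≤ 1 := by
  calc limitMean α u₀ x₀ t ≤ ∫⁻ _, 1 ∂clockLaw := lintegral_mono fun τ =>
        riccatiLimit_le_one hu hx τ t
    _ = 1 := by simp

/-- The excess of the mean over `1` satisfies the linear inequality obtained from
`(1 + v) ^ 2 ≥ 1 + 2 v`. -/
theorem exp_neg_mul_le_limitMean_sub_one {α : ℝ} {u₀ : ℝ≥0} (hu : 1 ≤ u₀) {t : ℝ} (ht : 0 ≤ t) :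
    ENNReal.ofReal (Real.exp (-t)) * (((u₀ - 1 : ℝ≥0) : ℝ≥0∞) + ∫⁻ σ in Ioc 0 t,
        ENNReal.ofReal (Real.exp σ) * (2 * (limitMean α u₀ 1 (α * σ) - 1)))
      ≤ limitMean α u₀ 1 t - 1 := by
  set U := limitMean α u₀ 1
  have hU : Measurable U := measurable_limitMean α u₀ 1
  have hone : ∀ s, U s = 1 + (U s - 1) := fun s => (add_tsub_cancel_of_le (one_le_limitMean hu s)).symm
  set w : ℝ≥0∞ := ((u₀ - 1 : ℝ≥0) : ℝ≥0∞) with hw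
  have hu₀ : (u₀ : ℝ≥0∞) = 1 + w := by
    rw [hw]
    exact_mod_cast (add_tsub_cancel_of_le hu).symm
  set J := ∫⁻ σ in Ioc 0 t, ENNReal.ofReal (Real.exp σ) * (2 * (U (α * σ) - 1))
  have hexp : (1 : ℝ≥0∞) + ∫⁻ σ in Ioc 0 t, ENNReal.ofReal (Real.exp σ)
      = ENNReal.ofReal (Real.exp t) := by
    rw [lintegral_Ioc_ofReal_exp ht, ← ENNReal.ofReal_one, ← ENNReal.ofReal_add zero_le_one
      (by simpa using ht)]
    simp
  have hJ : (∫⁻ σ in Ioc 0 t, ENNReal.ofReal (Real.exp σ)) + J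
      ≤ ∫⁻ σ in Ioc 0 t, ENNReal.ofReal (Real.exp σ) * U (α * σ) ^ 2 := by
    rw [← lintegral_add_left (by fun_prop)]
    refine lintegral_mono fun σ => ?_
    rw [← mul_one_add]
    gcongr
    conv_rhs => rw [hone (α * σ)]
    calc (1 : ℝ≥0∞) + 2 * (U (α * σ) - 1) ≤ 1 + 2 * (U (α * σ) - 1) + (U (α * σ) - 1) ^ 2 :=
          le_self_add
      _ = (1 + (U (α * σ) - 1)) ^ 2 := by ring
  have hmain : ENNReal.ofReal (Real.exp t) + (w + J) ≤
      ENNReal.ofReal (Real.exp t) + ENNReal.ofReal (Real.exp t) * (U t - 1) := by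
    rw [← mul_one_add, ← hone, (isExtendedRiccatiSolution_limitMean (Or.inr rfl) α u₀).exp_mul_eq ht,
      hu₀, ← hexp]
    calc _ = 1 + w + ((∫⁻ σ in Ioc 0 t, ENNReal.ofReal (Real.exp σ)) + J) := by ring
      _ ≤ _ := by gcongr
  have hcancel := (ENNReal.add_le_add_iff_left ENNReal.ofReal_ne_top).1 hmain
  calc _ ≤ ENNReal.ofReal (Real.exp (-t)) * (ENNReal.ofReal (Real.exp t) * (U t - 1)) := by gcongr
    _ = _ := by simpa using ofReal_exp_mul_ofReal_exp_neg_mul (-t) (U t - 1)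

/-- If the mean were finite, then `V = ∫ v` over `(0, T]`, where `v` is its excess over `1`, would
satisfy `V ≥ (2 / α) (1 - exp (-(1 - 1 / α) T)) V` with `0 < V < ∞`, and the factor exceeds `1`
for large `T`. -/
theorem limitMean_eq_top {α : ℝ} (h1 : 1 < α) (h2 : α < 2) {u₀ : ℝ≥0} (hu : 1 < u₀) {t : ℝ}
    (ht : 0 < t) : limitMean α u₀ 1 t = ∞ := by
  by_contra hcon
  have hα : 0 < α := by linarith
  have hsol := isExtendedRiccatiSolution_limitMean (x₀ := 1) (Or.inr rfl) α u₀
  have hfin : ∀ s, 0 ≤ s → limitMean α u₀ 1 s < ∞ := fun s hs =>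
    hsol.lt_top_forward h1 ht (lt_top_iff_ne_top.2 hcon) hs
  set v : ℝ → ℝ≥0∞ := fun s => limitMean α u₀ 1 s - 1
  have hvm : Measurable v := (measurable_limitMean α u₀ 1).sub_const 1
  -- the horizon `T` is chosen so that the exponential below equals `y`
  set y : ℝ := (1 - α / 2) / 2 with hy
  have hy0 : 0 < y := by simp only [hy]; linarith
  have hy1 : y < 1 := by simp only [hy]; linarith
  have hα1 : 0 < 1 - 1 / α := by
    have : 1 / α < 1 := (div_lt_one hα).2 h1
    linarith
  set T : ℝ := -Real.log y / (1 - 1 / α) with hT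
  have hT0 : 0 < T := div_pos (neg_pos.2 (Real.log_neg hy0 hy1)) hα1
  have hTy : Real.exp (T / α - T) = y := by
    have : T / α - T = Real.log y := by
      have : T * (1 - 1 / α) = -Real.log y := div_mul_cancel₀ _ hα1.ne'
      linear_combination -this
    rw [this, Real.exp_log hy0]
  have hpos : ∀ s ∈ Ioc 0 T, v s ≠ 0 := by
    intro s hs h0
    have h := exp_neg_mul_le_limitMean_sub_one (α := α) hu.le hs.1.le
    rw [show limitMean α u₀ 1 s - 1 = 0 from h0, nonpos_iff_eq_zero, mul_eq_zero, add_eq_zero] at h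
    rcases h with h | h
    · simp [not_le.2 (Real.exp_pos _)] at h
    · have h3 := h.1
      rw [ENNReal.coe_eq_zero, tsub_eq_zero_iff_le] at h3
      exact absurd h3 (not_le.2 hu)
  set V := ∫⁻ s in Ioc 0 T, v s
  have hVtop : V ≠ ∞ := by
    refine ne_of_lt ?_
    calc V ≤ ∫⁻ _ in Ioc 0 T, ENNReal.ofReal (Real.exp T) * limitMean α u₀ 1 T :=
          setLIntegral_mono measurable_const fun s hs =>
            tsub_le_self.trans (hsol.le_exp_mul hs.1.le hs.2)
      _ < ∞ := by
          rw [setLIntegral_const]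
          exact ENNReal.mul_lt_top (ENNReal.mul_lt_top ENNReal.ofReal_lt_top (hfin T hT0.le))
            measure_Ioc_lt_top
  have hV0 : V ≠ 0 := by
    intro h0
    have hne : (ae (volume.restrict (Ioc 0 T))).NeBot := by
      rw [ae_neBot]; simpa using hT0
    obtain ⟨s, hs, hsm⟩ := (((lintegral_eq_zero_iff hvm).1 h0).and
      (ae_restrict_mem measurableSet_Ioc)).exists
    exact hpos s hsm hs
  have hpre : (α * ·) ⁻¹' Ioc 0 T = Ioc 0 (T / α) := by
    ext x; simp [hα, le_div_iff₀' hα]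
  have hkey : ENNReal.ofReal (2 * (1 - y) / α) * V ≤ V := by
    have hm2 : Measurable fun σ => 2 * v (α * σ) := by fun_prop
    calc ENNReal.ofReal (2 * (1 - y) / α) * V
        = ∫⁻ σ in Ioc 0 (T / α), 2 * v (α * σ) * ENNReal.ofReal (1 - y) := by
          have h := setLIntegral_comp_const_mul hα (s := Ioc 0 T) measurableSet_Ioc hvm
          rw [hpre] at h
          rw [lintegral_mul_const _ hm2, lintegral_const_mul _ (by fun_prop), h,
            div_eq_mul_inv, ENNReal.ofReal_mul (by linarith), ENNReal.ofReal_mul zero_le_two,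
            ENNReal.ofReal_ofNat]
          ring
      _ ≤ ∫⁻ σ in Ioc 0 (T / α), 2 * v (α * σ) * (ENNReal.ofReal (Real.exp σ) *
            ∫⁻ s in Ioc 0 T, (Ici σ).indicator (fun s => ENNReal.ofReal (Real.exp (-s))) s) := by
          refine setLIntegral_mono' measurableSet_Ioc fun σ hσ => ?_
          gcongr
          have hσT : σ ≤ T := hσ.2.trans ((div_le_iff₀ hα).2 (by nlinarith))
          have hsub : Ioc σ T ⊆ Ici σ ∩ Ioc 0 T := fun x hx => ⟨hx.1.le, hσ.1.trans hx.1, hx.2⟩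
          have hint : ∫ s in σ..T, Real.exp (-s) = Real.exp (-σ) - Real.exp (-T) := by
            rw [intervalIntegral.integral_comp_neg (fun x => Real.exp x), integral_exp]
          rw [lintegral_indicator measurableSet_Ici, Measure.restrict_restrict measurableSet_Ici]
          calc ENNReal.ofReal (1 - y)
              ≤ ENNReal.ofReal (Real.exp σ * (Real.exp (-σ) - Real.exp (-T))) := by
                refine ENNReal.ofReal_le_ofReal ?_
                rw [mul_sub, ← Real.exp_add, ← Real.exp_add, add_neg_cancel, Real.exp_zero, ← hTy]
                gcongr
                linarith [hσ.2]
            _ = ENNReal.ofReal (Real.exp σ) * ∫⁻ s in Ioc σ T, ENNReal.ofReal (Real.exp (-s)) := by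
                rw [ENNReal.ofReal_mul (Real.exp_pos _).le, ← hint,
                  intervalIntegral.integral_of_le hσT, ofReal_integral_eq_lintegral_ofReal]
                · exact ((by fun_prop : Continuous fun s : ℝ =>
                    Real.exp (-s)).integrableOn_Icc).mono_set Ioc_subset_Icc_self
                · exact Eventually.of_forall fun s => (Real.exp_pos _).le
            _ ≤ _ := by
                gcongr
      _ ≤ ∫⁻ σ in Ioi 0, 2 * v (α * σ) * (ENNReal.ofReal (Real.exp σ) *
            ∫⁻ s in Ioc 0 T, (Ici σ).indicator (fun s => ENNReal.ofReal (Real.exp (-s))) s) :=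
          lintegral_mono_set Ioc_subset_Ioi_self
      _ = ∫⁻ s in Ioc 0 T, ENNReal.ofReal (Real.exp (-s)) *
            ∫⁻ σ in Ioc 0 s, ENNReal.ofReal (Real.exp σ) * (2 * v (α * σ)) :=
          (lintegral_exp_neg_mul_lintegral hm2).symm
      _ ≤ V := by
          refine setLIntegral_mono hvm fun s hs => ?_
          refine le_trans ?_ (exp_neg_mul_le_limitMean_sub_one (α := α) hu.le hs.1.le)
          gcongr
          exact le_add_self
  have hq : 1 < 2 * (1 - y) / α := by
    rw [lt_div_iff₀ hα, hy]
    linarith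
  have hlt : V < ENNReal.ofReal (2 * (1 - y) / α) * V := by
    conv_lhs => rw [← one_mul V]
    exact ENNReal.mul_lt_mul_left hV0 hVtop (by simpa using hq)
  exact absurd hkey (not_le.2 hlt)

/-! ### Convergence and the mean for a given family of clocks -/

theorem proposition4p1 {Ω : Type*} [MeasurableSpace Ω] (P : Measure Ω) [IsProbabilityMeasure P]
    (T : TreeVertex → Ω → ℝ) (hT : IsExpCascade P T) (α : ℝ) (hα : 0 ≤ α) (u₀ : ℝ≥0) :
    -- (i)
    ((α ≤ 1 ∨ 2 ≤ α) → ∀ x₀ : ℝ≥0, (x₀ = 0 ∨ x₀ = 1) →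
      (∀ t : ℝ, 0 ≤ t → ∀ᵐ ω ∂P,
        RiccatiConverges α u₀ x₀ (fun v => T v ω) t ∧
        riccatiLimit α u₀ x₀ (fun v => T v ω) t < ∞) ∧
      (∀ r : ℝ, 0 ≤ r → riccatiMean P T α u₀ x₀ r < ∞ →
        IsAlphaRiccatiSolutionOn α u₀ (Icc 0 r) (fun t => (riccatiMean P T α u₀ x₀ t).toReal)) ∧
      (u₀ ≤ 1 →
        (∀ t : ℝ, 0 ≤ t → riccatiMean P T α u₀ x₀ t < ∞) ∧
        IsAlphaRiccatiSolutionOn α u₀ (Ici 0)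
          (fun t => (riccatiMean P T α u₀ x₀ t).toReal))) ∧
    -- (ii)
    (1 < α → α < 2 →
      -- (a)
      (∀ t : ℝ, 0 ≤ t → ∀ᵐ ω ∂P,
        RiccatiConverges α u₀ 0 (fun v => T v ω) t ∧
        riccatiLimit α u₀ 0 (fun v => T v ω) t < ∞) ∧
      -- (b)
      (∀ t : ℝ, 0 ≤ t → ∀ᵐ ω ∂P, RiccatiConverges α u₀ 1 (fun v => T v ω) t) ∧
      (1 < u₀ → ∀ t : ℝ, 0 < t → riccatiMean P T α u₀ 1 t = ∞) ∧
      (u₀ ≤ 1 →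
        (∀ t : ℝ, 0 ≤ t → riccatiMean P T α u₀ 1 t < ∞) ∧
        IsAlphaRiccatiSolutionOn α u₀ (Ici 0)
          (fun t => (riccatiMean P T α u₀ 1 t).toReal))) := by
  have hTm : Measurable fun ω v => T v ω := measurable_pi_iff.2 hT.measurable
  simp only [riccatiMean_eq_limitMean hT]
  have hsmall : u₀ ≤ 1 → ∀ x₀ : ℝ≥0, (x₀ = 0 ∨ x₀ = 1) →
      (∀ t : ℝ, 0 ≤ t → limitMean α u₀ x₀ t < ∞) ∧
        IsAlphaRiccatiSolutionOn α u₀ (Ici 0) (fun t => (limitMean α u₀ x₀ t).toReal) := by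
    intro hu x₀ hx
    have hx1 : x₀ ≤ 1 := by rcases hx with rfl | rfl <;> simp
    have hfin : ∀ t : ℝ, 0 ≤ t → limitMean α u₀ x₀ t < ∞ := fun t _ =>
      (limitMean_le_one hu hx1 t).trans_lt ENNReal.one_lt_top
    exact ⟨hfin, (isExtendedRiccatiSolution_limitMean hx α u₀).isAlphaRiccatiSolutionOn_Ici hα hfin⟩
  have hzero : ∀ t : ℝ, 0 ≤ t → ∀ᵐ ω ∂P, RiccatiConverges α u₀ 0 (fun v => T v ω) t ∧
      riccatiLimit α u₀ 0 (fun v => T v ω) t < ∞ := fun t _ => Eventually.of_forall fun ω =>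
    ⟨riccatiConverges (Or.inl rfl) α u₀ _ t, riccatiLimit_zero_lt_top α u₀ _ t⟩
  refine ⟨fun hcase x₀ hx => ⟨?_, ?_, fun hu => hsmall hu x₀ hx⟩, fun h1 h2 => ⟨hzero, ?_, ?_, ?_⟩⟩
  · intro t ht
    rcases hx with rfl | rfl
    · exact hzero t ht
    · have hae := ae_riccatiLimit_one_lt_top hα hcase u₀ ht
      rw [← hT.map_eq_clockLaw] at hae
      filter_upwards [ae_of_ae_map hTm.aemeasurable hae] with ω hω
      exact ⟨riccatiConverges (Or.inr rfl) α u₀ _ t, hω⟩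
  · exact fun r hr hfin =>
      (isExtendedRiccatiSolution_limitMean hx α u₀).isAlphaRiccatiSolutionOn_Icc hα hr hfin
  · exact fun t _ => Eventually.of_forall fun ω => riccatiConverges (Or.inr rfl) α u₀ _ t
  · exact fun hu t ht => limitMean_eq_top h1 h2 hu ht
  · exact fun hu => hsmall hu 1 (Or.inr rfl)
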